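/- Let $G=(V,E)$ be a finite simple graph with $n=|V|$. For $S\subseteq V$ let $\delta(S)$ be the set of edges with exactly one end in $S$, and let $\mathrm{mc}(G)=\max_{S\subseteq V}|\delta(S)|$. Let $$\alpha_{GW}=\min_{\theta\in(0,\pi]}\frac{2}{\pi}\,\frac{\theta}{1-\cos\theta}\approx 0.878 .$$ For a real number $\eta\ge 0$, the randomized algorithm $\mathrm{PerturbGW}(G,\eta)$ is the following. 1. Take an optimal solution $(x_v)_{v\in V}$ of the semidefinite program: maximize $\frac12\sum_{uv\in E}(1-x_u\cdot x_v)$ subject to $x_v\in\mathbb{S}^{n-1}\subset\mathbb{R}^n$ for all $v\in V$. 2. Sample a standard Gaussian vector $r\sim\mathcal N(0,1)^n$. For each $v\in V$ let $s_v=\operatorname{sign}(r\cdot x_v)\in\{-1,1\}$ (with $\operatorname{sign}(0)=1$). If $|r\cdot x_v|\ge\eta$, let $s'_v=s_v$; otherwise draw $s'_v$ uniformly from $\{-1,1\}$, independently of $r$ and of the draws for other vertices. 3. Let $S=\{v: s_v=1\}$ and $S'=\{v: s'_v=1\}$, and return the larger of the two cuts $\delta(S)$ and $\delta(S')$. **Theorem.**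 Let $t$ be a real number and suppose that $G$ contains at least $t|E|$ pairwise edge-disjoint triangles. Then, whichever optimal solution $(x_v)$ is used in step 1, the cut returned by $\mathrm{PerturbGW}(G,\eta)$ with $\eta=t^2/10^4$ has expected size $$\mathbb{E}\,\bigl|\mathrm{PerturbGW}(G,t^2/10^4)\bigr|=\mathbb{E}\max\{|\delta(S)|,|\delta(S')|\}\ \ge\ \bigl(\alpha_{GW}+10^{-10}t^3\bigr)\,\mathrm{mc}(G).$$ -/

import Mathlib

open MeasureTheory ProbabilityTheory

noncomputable section

namespace PerturbGW

/-- The Goemans-Williamson constant: the minimum of `(2/π) · θ / (1 - cos θ)`. The angle `0` is left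
out because the expression is `0/0` there (it tends to `+∞` as `θ → 0`). -/
def alphaGW : ℝ :=
  sInf ((fun θ : ℝ => 2 / Real.pi * (θ / (1 - Real.cos θ))) '' Set.Ioc 0 Real.pi)

section Graph

variable {V : Type*} [Fintype V] [DecidableEq V] (G : SimpleGraph V) [DecidableRel G.Adj]

/-- The cut `δ(S)`: the set of edges with one end in `S` and the other end outside `S`. -/
def cut (S : Finset V) : Finset (Sym2 V) :=
  G.edgeFinset.filter fun e => ∃ u v, e = s(u, v) ∧ u ∈ S ∧ v ∉ S

/-- The size of a maximum cut. -/
def mc : ℕ := (Finset.univ : Finset (Finset V)).sup fun S => (cut G S).card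

/-- `T` is a triangle of `G`, seen as a set of three edges `{uv, vw, wu}`. -/
def IsTriangle (T : Finset (Sym2 V)) : Prop :=
  ∃ u v w, G.Adj u v ∧ G.Adj v w ∧ G.Adj w u ∧ T = {s(u, v), s(v, w), s(w, u)}

/-- `G` has `k` pairwise edge-disjoint triangles. -/
def HasTrianglePacking (k : ℕ) : Prop :=
  ∃ P : Finset (Finset (Sym2 V)), P.card = k ∧ (∀ T ∈ P, IsTriangle G T) ∧
    (P : Set (Finset (Sym2 V))).PairwiseDisjoint id

/-- The space `ℝⁿ` with `n = |V|`. -/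
abbrev Space (V : Type*) [Fintype V] : Type := EuclideanSpace ℝ (Fin (Fintype.card V))

/-- The SDP objective `½ ∑_{uv ∈ E} (1 - x_u · x_v)`. -/
def sdpValue (x : V → Space V) : ℝ :=
  1 / 2 * ∑ e ∈ G.edgeFinset,
    e.lift ⟨fun u v => 1 - inner ℝ (x u) (x v), fun u v => by simp only [real_inner_comm]⟩

/-- The feasible points of the SDP: all vectors lie on the unit sphere. -/
def sdpFeasible (V : Type*) [Fintype V] : Set (V → Space V) :=
  {x | ∀ v, x v ∈ Metric.sphere (0 : Space V) 1}

/-- `x` is an optimal solution of the SDP. -/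
def IsSDPOptimal (x : V → Space V) : Prop :=
  x ∈ sdpFeasible V ∧ IsMaxOn (sdpValue G) (sdpFeasible V) x

/-- The randomness of the algorithm: a standard Gaussian vector `r ∼ N(0,1)ⁿ` and, independently,
one fair coin for each vertex (consulted only if the sign of that vertex is resampled). -/
def randomness (V : Type*) [Fintype V] : Measure (Space V × (V → Bool)) :=
  (stdGaussian (Space V)).prod
    (Measure.pi fun _ : V => (PMF.uniformOfFintype Bool).toMeasure)

/-- The sign of a real number, with `true` for `+1` and `false` for `-1`. -/
def sgn (a : ℝ) : Bool := decide (0 ≤ a)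

/-- The signs `s_v = sign (r · x_v)` of hyperplane rounding. -/
def sign (x : V → Space V) (r : Space V) (v : V) : Bool := sgn (inner ℝ r (x v))

/-- The perturbed signs: `s_v` is kept if `|r · x_v| ≥ η` and replaced by the coin of `v`
otherwise. -/
def sign' (η : ℝ) (x : V → Space V) (r : Space V) (coin : V → Bool) (v : V) : Bool :=
  open Classical in if η ≤ |inner ℝ r (x v)| then sign x r v else coin v

/-- The cut that the algorithm returns, given the optimal solution `x`, the Gaussian vector `ω.1`
and the coins `ω.2`: the larger of `δ(S)` and `δ(S')`. -/
def perturbGW (η : ℝ) (x : V → Space V) (ω : Space V × (V → Bool)) : Finset (Sym2 V) :=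
  let S : Finset V := Finset.univ.filter fun v => sign x ω.1 v = true
  let S' : Finset V := Finset.univ.filter fun v => sign' η x ω.1 ω.2 v = true
  if (cut G S).card < (cut G S').card then cut G S' else cut G S

end Graph

end PerturbGW

end

namespace PerturbGW

/-! The argument compares, edge by edge, the probability of being cut with `alphaGW` times the
edge's share of the SDP value, which is `(1 - cos θ) / 2` for an edge at angle `θ`. Plain rounding
cuts the edge with probability at least `θ / π`, so it never falls below this benchmark
(`alphaGW_mul_le`).

Perturbation costs only second order in `η` when `θ ≤ 9π/10`. If one end is resampled, the new signs
differ with probability exactly `1/2`. The old signs, given that one projection is small, differ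
with probability only slightly above `1/2`: reflecting the small projection nearly exchanges
agreement and disagreement, with an exceptional set of measure `O(η²)`
(`planeGaussian_disagree_le`). Closer to `π` the loss is of order `η`, but there `θ / π` exceeds
`alphaGW` by a constant.

For `θ ≤ 2π/3` there is a gain of order `η`. If `θ > η`, plain rounding beats the benchmark by a
multiple of `θ`, because the worst angle lies beyond `2π/3`; if `θ ≤ η`, the benchmark is `O(η²)`
while the coins cut the edge with probability of order `η`. All cases meet in
`le_randomness_separate'`.

Three unit vectors cannot be pairwise at angles above `2π/3`, so `k` edge-disjoint triangles supply
`k` gaining edges. The total excess is at least `k η / 1000 - 4 η² |E|`, and with `k ≥ t |E|` and `η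
= t² / 10⁴` the gain of order `t³ |E|` dominates the loss of order `t⁴ |E|`. Finally `mc` is at most
both the SDP value and `|E|`. -/

lemma sgn_of_nonneg {a : ℝ} (h : 0 ≤ a) : sgn a = true := decide_eq_true h

lemma sgn_of_neg {a : ℝ} (h : a < 0) : sgn a = false := decide_eq_false (not_le.2 h)

lemma measurable_sgn : Measurable sgn := by
  apply measurable_to_bool
  have : sgn ⁻¹' {true} = Set.Ici 0 := by ext; simp [sgn]
  rw [this]
  exact measurableSet_Ici

/-! ### Estimates for the Gaussian measure on the line and the plane. -/

section Gaussian

/-- The standard Gaussian measure on the plane. -/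
noncomputable abbrev planeGaussian : Measure (ℝ × ℝ) := (gaussianReal 0 1).prod (gaussianReal 0 1)

lemma gaussianPDFReal_le (x : ℝ) : gaussianPDFReal 0 1 x ≤ 2 / 5 := by
  have hs : (5 / 2 : ℝ) ≤ √(2 * Real.pi) := by
    apply Real.le_sqrt_of_sq_le
    nlinarith [Real.pi_gt_d2]
  have h1 : (√(2 * Real.pi))⁻¹ ≤ 2 / 5 := by
    calc (√(2 * Real.pi))⁻¹ ≤ (5 / 2 : ℝ)⁻¹ := inv_anti₀ (by norm_num) hs
      _ = 2 / 5 := by norm_num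
  have h2 : Real.exp (-x ^ 2 / 2) ≤ 1 := Real.exp_le_one_iff.2 (by nlinarith [sq_nonneg x])
  simp only [gaussianPDFReal_def, NNReal.coe_one, mul_one, sub_zero]
  calc _ ≤ (2 / 5 : ℝ) * 1 := mul_le_mul h1 h2 (Real.exp_nonneg _) (by norm_num)
    _ = 2 / 5 := by norm_num

lemma le_gaussianPDFReal {x : ℝ} (hx : |x| ≤ 1 / 2) : 3 / 10 ≤ gaussianPDFReal 0 1 x := by
  have hs : √(2 * Real.pi) ≤ 13 / 5 := by
    rw [Real.sqrt_le_left (by norm_num)]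
    nlinarith [Real.pi_lt_d2]
  have h0 : 0 < √(2 * Real.pi) := by positivity
  have h1 : 5 / 13 ≤ (√(2 * Real.pi))⁻¹ := by
    calc (5 / 13 : ℝ) = (13 / 5 : ℝ)⁻¹ := by norm_num
      _ ≤ _ := inv_anti₀ h0 hs
  have hx2 : x ^ 2 ≤ 1 / 4 := by
    rw [← sq_abs]; nlinarith [abs_nonneg x]
  have h2 : 7 / 8 ≤ Real.exp (-x ^ 2 / 2) := by
    have := Real.add_one_le_exp (-x ^ 2 / 2)
    linarith
  simp only [gaussianPDFReal_def, NNReal.coe_one, mul_one, sub_zero]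
  calc (3 / 10 : ℝ) ≤ 5 / 13 * (7 / 8) := by norm_num
    _ ≤ _ := mul_le_mul h1 h2 (by norm_num) (by positivity)

lemma gaussianReal_le_volume (s : Set ℝ) :
    gaussianReal 0 1 s ≤ ENNReal.ofReal (2 / 5) * volume s := by
  rw [gaussianReal_apply 0 one_ne_zero, ← setLIntegral_const]
  exact lintegral_mono fun x => ENNReal.ofReal_le_ofReal (gaussianPDFReal_le x)

lemma gaussianReal_Icc_le {a b : ℝ} :
    gaussianReal 0 1 (Set.Icc a b) ≤ ENNReal.ofReal (2 / 5 * (b - a)) := by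
  refine (gaussianReal_le_volume _).trans ?_
  rw [Real.volume_Icc, ← ENNReal.ofReal_mul (by norm_num)]

lemma gaussianReal_Ioo_neg_le {η : ℝ} :
    gaussianReal 0 1 (Set.Ioo (-η) η) ≤ ENNReal.ofReal (4 / 5 * η) := by
  refine (gaussianReal_le_volume _).trans ?_
  rw [Real.volume_Ioo, ← ENNReal.ofReal_mul (by norm_num)]
  apply ENNReal.ofReal_le_ofReal
  linarith

lemma le_gaussianReal_Ioo_neg {η : ℝ} (hη : η ≤ 1 / 2) :
    ENNReal.ofReal (3 / 5 * η) ≤ gaussianReal 0 1 (Set.Ioo (-η) η) := by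
  rw [gaussianReal_apply 0 one_ne_zero]
  calc ENNReal.ofReal (3 / 5 * η) = ENNReal.ofReal (3 / 10) * volume (Set.Ioo (-η) η) := by
        rw [Real.volume_Ioo, ← ENNReal.ofReal_mul (by norm_num)]
        congr 1; ring
    _ = ∫⁻ _ in Set.Ioo (-η) η, ENNReal.ofReal (3 / 10) := by rw [setLIntegral_const]
    _ ≤ _ := setLIntegral_mono' measurableSet_Ioo fun x hx => by
        apply ENNReal.ofReal_le_ofReal (le_gaussianPDFReal _)
        rw [abs_le]; constructor <;> linarith [hx.1, hx.2]

lemma gaussianReal_prod_eq_withDensity :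
    planeGaussian = (volume : Measure (ℝ × ℝ)).withDensity fun p =>
      ENNReal.ofReal ((2 * Real.pi)⁻¹ * Real.exp (-(1 / 2) * (p.1 ^ 2 + p.2 ^ 2))) := by
  rw [planeGaussian, gaussianReal_of_var_ne_zero 0 one_ne_zero,
    prod_withDensity (measurable_gaussianPDF 0 1) (measurable_gaussianPDF 0 1),
    ← Measure.volume_eq_prod]
  congr 1
  ext p
  rw [gaussianPDF, gaussianPDF, ← ENNReal.ofReal_mul (gaussianPDFReal_nonneg _ _ _)]
  congr 1
  simp only [gaussianPDFReal_def, NNReal.coe_one, mul_one, sub_zero]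
  rw [mul_mul_mul_comm, ← mul_inv, Real.mul_self_sqrt (by positivity), ← Real.exp_add]
  congr 2
  ring

lemma lintegral_radial :
    ∫⁻ r in Set.Ioi (0 : ℝ), ENNReal.ofReal (r * Real.exp (-(1 / 2) * r ^ 2)) = 1 := by
  have hb : (0 : ℝ) < 1 / 2 := by norm_num
  rw [← ofReal_integral_eq_lintegral_ofReal (integrable_mul_exp_neg_mul_sq hb).integrableOn]
  · have h := integral_mul_cexp_neg_mul_sq (b := (1 / 2 : ℂ)) (by norm_num)
    have h2 : ((∫ r in Set.Ioi (0 : ℝ), r * Real.exp (-(1 / 2) * r ^ 2) : ℝ) : ℂ) = 1 := by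
      rw [← integral_complex_ofReal]
      push_cast
      rw [h]; norm_num
    have h3 : (∫ r in Set.Ioi (0 : ℝ), r * Real.exp (-(1 / 2) * r ^ 2)) = 1 := by
      exact_mod_cast h2
    rw [h3, ENNReal.ofReal_one]
  · filter_upwards [ae_restrict_mem measurableSet_Ioi] with r hr
    exact mul_nonneg (le_of_lt hr) (Real.exp_nonneg _)

lemma measurable_linear (c s : ℝ) : Measurable fun p : ℝ × ℝ => c * p.1 + s * p.2 := by fun_prop

/-- The Gaussian measure of a set containing an angular sector. -/
lemma planeGaussian_ge_of_sector {S : Set (ℝ × ℝ)} (hS : MeasurableSet S) {a b : ℝ}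
    (ha : -Real.pi ≤ a) (hb : b ≤ Real.pi)
    (h : ∀ r > 0, ∀ φ ∈ Set.Ioo a b, (r * Real.cos φ, r * Real.sin φ) ∈ S) :
    ENNReal.ofReal ((b - a) / (2 * Real.pi)) ≤ planeGaussian S := by
  rw [gaussianReal_prod_eq_withDensity, withDensity_apply _ hS, ← lintegral_indicator hS,
    ← lintegral_comp_polarCoord_symm]
  have hsub : Set.Ioi (0 : ℝ) ×ˢ Set.Ioo a b ⊆ polarCoord.target := by
    rw [polarCoord_target]
    exact Set.prod_mono_right (Set.Ioo_subset_Ioo ha hb)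
  refine le_trans ?_ (lintegral_mono_set hsub)
  calc ENNReal.ofReal ((b - a) / (2 * Real.pi))
      = (∫⁻ r in Set.Ioi (0 : ℝ), ENNReal.ofReal (r * Real.exp (-(1 / 2) * r ^ 2))) *
          ∫⁻ _ in Set.Ioo a b, ENNReal.ofReal ((2 * Real.pi)⁻¹) := by
        rw [lintegral_radial, one_mul, setLIntegral_const, Real.volume_Ioo,
          ← ENNReal.ofReal_mul (by positivity)]
        congr 1; ring
    _ = ∫⁻ p in Set.Ioi (0 : ℝ) ×ˢ Set.Ioo a b,
          ENNReal.ofReal (p.1 * Real.exp (-(1 / 2) * p.1 ^ 2)) *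
            ENNReal.ofReal ((2 * Real.pi)⁻¹) := by
        rw [Measure.volume_eq_prod, ← Measure.prod_restrict]
        exact (lintegral_prod_mul (by fun_prop) (by fun_prop)).symm
    _ ≤ _ := by
        refine setLIntegral_mono' (measurableSet_Ioi.prod measurableSet_Ioo) fun p hp => ?_
        have hp1 : 0 < p.1 := hp.1
        rw [polarCoord_symm_apply, Set.indicator_of_mem (h p.1 hp1 p.2 hp.2), smul_eq_mul,
          ← ENNReal.ofReal_mul (by positivity), ← ENNReal.ofReal_mul hp1.le]
        apply ENNReal.ofReal_le_ofReal
        have : (p.1 * Real.cos p.2) ^ 2 + (p.1 * Real.sin p.2) ^ 2 = p.1 ^ 2 := by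
          rw [mul_pow, mul_pow, ← mul_add, Real.cos_sq_add_sin_sq, mul_one]
        simp only [this]
        apply le_of_eq; ring

/-- Hyperplane rounding separates two unit vectors at angle `θ` with probability at least `θ / π`;
this is the half in which the first sign is positive. -/
lemma planeGaussian_pos_neg {θ : ℝ} (h0 : 0 ≤ θ) (hπ : θ ≤ Real.pi) :
    ENNReal.ofReal (θ / (2 * Real.pi)) ≤
      planeGaussian {p | 0 < p.1 ∧ Real.cos θ * p.1 + Real.sin θ * p.2 < 0} := by
  have hS : MeasurableSet
      {p : ℝ × ℝ | 0 < p.1 ∧ Real.cos θ * p.1 + Real.sin θ * p.2 < 0} :=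
    (measurableSet_lt measurable_const measurable_fst).inter
      (measurableSet_lt (measurable_linear _ _) measurable_const)
  -- At polar angle `φ` the two linear forms are `r cos φ` and `r cos (θ - φ)`, which have the
  -- required signs on this sector of width `θ`.
  have := planeGaussian_ge_of_sector hS (a := -(Real.pi / 2)) (b := θ - Real.pi / 2)
    (by linarith [Real.pi_pos]) (by linarith [Real.pi_pos]) ?_
  · convert this using 3
    ring
  intro r hr φ hφ
  refine ⟨mul_pos hr (Real.cos_pos_of_mem_Ioo ⟨hφ.1, by linarith [hφ.2]⟩), ?_⟩
  have : Real.cos (θ - φ) < 0 :=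
    Real.cos_neg_of_pi_div_two_lt_of_lt (by linarith [hφ.2]) (by linarith [hφ.1])
  rw [Real.cos_sub] at this
  simp only
  nlinarith

lemma measurePreserving_neg_prod_neg :
    MeasurePreserving (fun p : ℝ × ℝ => (-p.1, -p.2)) planeGaussian planeGaussian := by
  have h : MeasurePreserving (fun x : ℝ => -x) (gaussianReal 0 1) (gaussianReal 0 1) :=
    ⟨measurable_neg, by rw [gaussianReal_map_neg, neg_zero]⟩
  exact h.prod h

lemma measurePreserving_neg_prod_id :
    MeasurePreserving (fun p : ℝ × ℝ => (-p.1, p.2)) planeGaussian planeGaussian := by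
  have h : MeasurePreserving (fun x : ℝ => -x) (gaussianReal 0 1) (gaussianReal 0 1) :=
    ⟨measurable_neg, by rw [gaussianReal_map_neg, neg_zero]⟩
  exact h.prod (MeasurePreserving.id _)

/-- The separating event contains two opposite sectors, exchanged by `p ↦ -p`, each of measure at
least `θ / (2π)`. -/
lemma planeGaussian_separate {θ : ℝ} (h0 : 0 ≤ θ) (hπ : θ ≤ Real.pi) :
    ENNReal.ofReal (θ / Real.pi) ≤
      planeGaussian {p | sgn p.1 ≠ sgn (Real.cos θ * p.1 + Real.sin θ * p.2)} := by
  set S : Set (ℝ × ℝ) := {p | 0 < p.1 ∧ Real.cos θ * p.1 + Real.sin θ * p.2 < 0} with hSdef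
  set T : Set (ℝ × ℝ) := {p | p.1 < 0 ∧ 0 < Real.cos θ * p.1 + Real.sin θ * p.2} with hTdef
  have hS : MeasurableSet S :=
    (measurableSet_lt measurable_const measurable_fst).inter
      (measurableSet_lt (measurable_linear _ _) measurable_const)
  have hT : MeasurableSet T :=
    (measurableSet_lt measurable_fst measurable_const).inter
      (measurableSet_lt measurable_const (measurable_linear _ _))
  have hTS : planeGaussian T = planeGaussian S := by
    rw [← measurePreserving_neg_prod_neg.measure_preimage hS.nullMeasurableSet]
    congr 1
    ext p
    simp only [hSdef, hTdef, Set.mem_ofPred_eq, Set.mem_preimage]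
    constructor <;> rintro ⟨h1, h2⟩ <;> constructor <;> linarith
  have hdisj : Disjoint S T := by
    rw [Set.disjoint_left]
    rintro p ⟨h1, -⟩ ⟨h2, -⟩
    exact lt_asymm h1 h2
  have hpos := planeGaussian_pos_neg h0 hπ
  have h2 : (0 : ℝ) ≤ θ / (2 * Real.pi) := div_nonneg h0 (by positivity)
  calc ENNReal.ofReal (θ / Real.pi)
      = ENNReal.ofReal (θ / (2 * Real.pi)) + ENNReal.ofReal (θ / (2 * Real.pi)) := by
        rw [← ENNReal.ofReal_add h2 h2]
        congr 1
        have := Real.pi_ne_zero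
        field_simp
        ring
    _ ≤ planeGaussian S + planeGaussian T := by rw [hTS]; exact add_le_add hpos hpos
    _ = planeGaussian (S ∪ T) := (measure_union hdisj hT).symm
    _ ≤ _ := by
        apply measure_mono
        rintro p (⟨h1, h2⟩ | ⟨h1, h2⟩)
        · simp [sgn_of_nonneg h1.le, sgn_of_neg h2]
        · simp [sgn_of_neg h1, sgn_of_nonneg h2.le]

/-- The signs of two Gaussians of correlation at least `-κ`, restricted to the event that the first
one is small and the second one is not, disagree at most slightly more often than they agree. -/
lemma planeGaussian_disagree_le {ρ s κ η τ : ℝ} (hs : 0 < s) (hκ : 0 ≤ κ) (hρ : -κ ≤ ρ)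
    (hη : 0 ≤ η) (hτ : 0 ≤ τ) :
    planeGaussian {p | |p.1| < η ∧ τ ≤ |ρ * p.1 + s * p.2| ∧ sgn p.1 ≠ sgn (ρ * p.1 + s * p.2)} ≤
      planeGaussian
          {p | |p.1| < η ∧ τ ≤ |ρ * p.1 + s * p.2| ∧ sgn p.1 = sgn (ρ * p.1 + s * p.2)} +
        ENNReal.ofReal (16 / 25 * (κ * η ^ 2 / s)) := by
  set M : Set (ℝ × ℝ) :=
    {p | |p.1| < η ∧ τ ≤ |ρ * p.1 + s * p.2| ∧ sgn p.1 ≠ sgn (ρ * p.1 + s * p.2)}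
  set P : Set (ℝ × ℝ) :=
    {p | |p.1| < η ∧ τ ≤ |ρ * p.1 + s * p.2| ∧ sgn p.1 = sgn (ρ * p.1 + s * p.2)} with hP
  -- Reflecting `p.1` moves the second form by `2 ρ p.1`, towards zero by at most `2 κ η` on a
  -- disagreeing pair. `B` collects the points where this shift may cross the threshold `τ`: for
  -- each `p.1`, an interval of length `2 κ η / s` in `p.2`.
  set B : Set (ℝ × ℝ) := {p | p.1 ∈ Set.Ioo (-η) η ∧
    ((0 ≤ p.1 ∧ -τ - 2 * κ * η ≤ ρ * p.1 + s * p.2 ∧ ρ * p.1 + s * p.2 ≤ -τ) ∨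
     (p.1 < 0 ∧ τ ≤ ρ * p.1 + s * p.2 ∧ ρ * p.1 + s * p.2 ≤ τ + 2 * κ * η))} with hB
  -- On this null line the reflection does not flip the sign, since `sgn 0 = true`.
  set N : Set (ℝ × ℝ) := {0} ×ˢ Set.univ with hN
  have hPm : MeasurableSet P :=
    (measurableSet_lt measurable_fst.abs measurable_const).inter
      ((measurableSet_le measurable_const (measurable_linear _ _).abs).inter
        (measurableSet_eq_fun (measurable_sgn.comp measurable_fst)
          (measurable_sgn.comp (measurable_linear _ _))))
  have hN0 : planeGaussian N = 0 := by
    have := nullSingletonClass_gaussianReal (μ := 0) (v := 1) one_ne_zero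
    rw [hN, Measure.prod_prod, measure_singleton, zero_mul]
  have hBm : MeasurableSet B := by
    apply MeasurableSet.inter
    · exact measurable_fst measurableSet_Ioo
    · apply MeasurableSet.union
      · exact (measurableSet_le measurable_const measurable_fst).inter
          ((measurableSet_le measurable_const (measurable_linear _ _)).inter
            (measurableSet_le (measurable_linear _ _) measurable_const))
      · exact (measurableSet_lt measurable_fst measurable_const).inter
          ((measurableSet_le measurable_const (measurable_linear _ _)).inter
            (measurableSet_le (measurable_linear _ _) measurable_const))
  have hBle : planeGaussian B ≤ ENNReal.ofReal (16 / 25 * (κ * η ^ 2 / s)) := by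
    rw [Measure.prod_apply hBm]
    calc ∫⁻ x, gaussianReal 0 1 (Prod.mk x ⁻¹' B) ∂gaussianReal 0 1
        ≤ ∫⁻ x, (Set.Ioo (-η) η).indicator
            (fun _ => ENNReal.ofReal (2 / 5 * (2 * κ * η / s))) x ∂gaussianReal 0 1 := by
          refine lintegral_mono fun x => ?_
          by_cases hx : x ∈ Set.Ioo (-η) η
          · rw [Set.indicator_of_mem hx]
            rcases le_or_gt 0 x with h | h
            · have : Prod.mk x ⁻¹' B ⊆
                  Set.Icc ((-τ - 2 * κ * η - ρ * x) / s) ((-τ - ρ * x) / s) := by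
                rintro y ⟨-, (⟨-, h1, h2⟩ | ⟨h1, -⟩)⟩
                · simp only at h1 h2
                  rw [Set.mem_Icc, div_le_iff₀ hs, le_div_iff₀ hs]
                  constructor <;> linarith
                · exact absurd h1 (not_lt.2 h)
              refine (measure_mono this).trans (gaussianReal_Icc_le.trans (le_of_eq ?_))
              congr 1; ring
            · have : Prod.mk x ⁻¹' B ⊆
                  Set.Icc ((τ - ρ * x) / s) ((τ + 2 * κ * η - ρ * x) / s) := by
                rintro y ⟨-, (⟨h1, -⟩ | ⟨-, h1, h2⟩)⟩
                · exact absurd h (not_lt.2 h1)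
                · simp only at h1 h2
                  rw [Set.mem_Icc, div_le_iff₀ hs, le_div_iff₀ hs]
                  constructor <;> linarith
              refine (measure_mono this).trans (gaussianReal_Icc_le.trans (le_of_eq ?_))
              congr 1; ring
          · have : Prod.mk x ⁻¹' B = ∅ := by
              ext y
              simp only [hB, Set.mem_preimage, Set.mem_ofPred_eq, hx, false_and,
                Set.mem_empty_iff_false]
            rw [this, measure_empty]
            exact zero_le
      _ = ENNReal.ofReal (2 / 5 * (2 * κ * η / s)) * gaussianReal 0 1 (Set.Ioo (-η) η) := by
          rw [lintegral_indicator_const measurableSet_Ioo]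
      _ ≤ ENNReal.ofReal (2 / 5 * (2 * κ * η / s)) * ENNReal.ofReal (4 / 5 * η) := by
          gcongr; exact gaussianReal_Ioo_neg_le
      _ = _ := by
          rw [← ENNReal.ofReal_mul (by positivity)]
          congr 1; ring
  have hsub : M ⊆ ((fun p : ℝ × ℝ => (-p.1, p.2)) ⁻¹' P ∪ B) ∪ N := by
    rintro ⟨a, g⟩ ⟨h1, h2, h3⟩
    simp only at h1 h2 h3
    by_contra hcon
    simp only [Set.mem_union, not_or] at hcon
    obtain ⟨⟨hc1, hc2⟩, hc3⟩ := hcon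
    have ha0 : a ≠ 0 := fun h => hc3 (by simp [hN, h])
    have hab := abs_lt.1 h1
    apply hc1
    simp only [hP, Set.mem_preimage, Set.mem_ofPred_eq, abs_neg]
    refine ⟨h1, ?_⟩
    rcases lt_or_gt_of_ne ha0 with ha | ha
    · have hb : 0 ≤ ρ * a + s * g := by
        by_contra hb
        exact h3 (by rw [sgn_of_neg ha, sgn_of_neg (lt_of_not_ge hb)])
      rw [abs_of_nonneg hb] at h2
      have hb' : τ ≤ ρ * -a + s * g := by
        by_contra hlt
        apply hc2
        refine ⟨hab, Or.inr ⟨ha, h2, ?_⟩⟩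
        simp only
        nlinarith
      have hb0 : 0 ≤ ρ * -a + s * g := hτ.trans hb'
      rw [abs_of_nonneg hb0]
      refine ⟨hb', ?_⟩
      rw [sgn_of_nonneg hb0, sgn_of_nonneg (by linarith)]
    · have hb : ρ * a + s * g < 0 := by
        by_contra hb
        exact h3 (by rw [sgn_of_nonneg ha.le, sgn_of_nonneg (le_of_not_gt hb)])
      rw [abs_of_neg hb] at h2
      have hb' : ρ * -a + s * g < 0 ∧ τ ≤ -(ρ * -a + s * g) := by
        by_contra hlt
        apply hc2
        refine ⟨hab, Or.inl ⟨ha.le, ?_, by simp only; linarith⟩⟩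
        simp only
        by_contra hlt2
        apply hlt
        have : 2 * κ * a ≤ 2 * κ * η := by nlinarith [hab.2]
        constructor <;> nlinarith
      rw [abs_of_neg hb'.1]
      refine ⟨hb'.2, ?_⟩
      rw [sgn_of_neg hb'.1, sgn_of_neg (by linarith)]
  calc planeGaussian M ≤ planeGaussian (((fun p : ℝ × ℝ => (-p.1, p.2)) ⁻¹' P ∪ B) ∪ N) :=
        measure_mono hsub
    _ ≤ planeGaussian ((fun p : ℝ × ℝ => (-p.1, p.2)) ⁻¹' P) + planeGaussian B
          + planeGaussian N := (measure_union_le _ _).trans (by gcongr; exact measure_union_le _ _)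
    _ ≤ planeGaussian P + ENNReal.ofReal (16 / 25 * (κ * η ^ 2 / s)) := by
        rw [hN0, add_zero, measurePreserving_neg_prod_id.measure_preimage hPm.nullMeasurableSet]
        gcongr

end Gaussian

/-! ### Reduction of two projections of a Gaussian vector to the plane. -/

section Projection

lemma exists_orthonormal_decomposition {E : Type*} [NormedAddCommGroup E]
    [InnerProductSpace ℝ E] [FiniteDimensional ℝ E] (hdim : 2 ≤ Module.finrank ℝ E) {u v : E} (hu : ‖u‖ = 1)
    (hv : ‖v‖ = 1) :
    ∃ w : E, ‖w‖ = 1 ∧ inner ℝ u w = 0 ∧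
      v = Real.cos (Real.arccos (inner ℝ u v)) • u + Real.sin (Real.arccos (inner ℝ u v)) • w := by
  set ρ : ℝ := inner ℝ u v with hρ
  have habs : |ρ| ≤ 1 := by
    have := abs_real_inner_le_norm u v
    rwa [hu, hv, one_mul] at this
  rw [Real.cos_arccos (abs_le.1 habs).1 (abs_le.1 habs).2, Real.sin_arccos]
  have huu : inner ℝ u u = 1 := by rw [real_inner_self_eq_norm_sq, hu, one_pow]
  have hperp : inner ℝ u (v - ρ • u) = 0 := by
    rw [inner_sub_right, real_inner_smul_right, huu, mul_one, ← hρ, sub_self]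
  have hnorm : ‖v - ρ • u‖ = √(1 - ρ ^ 2) := by
    rw [← Real.sqrt_sq (norm_nonneg (v - ρ • u))]
    congr 1
    rw [norm_sub_sq_real, norm_smul, hu, hv, real_inner_smul_right, real_inner_comm, ← hρ,
      Real.norm_eq_abs, mul_one, sq_abs]
    ring
  -- When `v = ±u` the sine vanishes and any unit `w` orthogonal to `u` serves; this is where
  -- dimension at least two is needed.
  by_cases h0 : v - ρ • u = 0
  · obtain ⟨w, hw⟩ : ∃ w : (ℝ ∙ u)ᗮ, ‖w‖ = 1 := by
      have hf : 0 < Module.finrank ℝ (ℝ ∙ u)ᗮ := by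
        have h1 := Submodule.finrank_add_finrank_orthogonal (ℝ ∙ u)
        have h2 := finrank_span_singleton (K := ℝ) (v := u) (by rintro rfl; simp at hu)
        omega
      have := Module.nontrivial_of_finrank_pos hf
      exact exists_norm_eq _ zero_le_one
    refine ⟨w, hw, Submodule.mem_orthogonal_singleton_iff_inner_right.1 w.2, ?_⟩
    rw [← hnorm, h0, norm_zero, zero_smul, add_zero]
    exact sub_eq_zero.1 h0
  · have hn : ‖v - ρ • u‖ ≠ 0 := norm_ne_zero_iff.2 h0
    refine ⟨‖v - ρ • u‖⁻¹ • (v - ρ • u), ?_, ?_, ?_⟩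
    · rw [norm_smul, norm_inv, norm_norm, inv_mul_cancel₀ hn]
    · rw [real_inner_smul_right, hperp, mul_zero]
    · rw [← hnorm, smul_smul, mul_inv_cancel₀ hn, one_smul]
      abel

variable {E : Type*} [NormedAddCommGroup E] [InnerProductSpace ℝ E] [FiniteDimensional ℝ E]
  [MeasurableSpace E] [BorelSpace E]

/-- Characteristic functions determine the law. For a functional with coordinates `a, b`,
orthonormality makes its pullback have squared norm `a² + b²`, so both sides are `exp (-(a² + b²) /
2)`. -/
lemma measurePreserving_inner_pair {u w : E} (hu : ‖u‖ = 1) (hw : ‖w‖ = 1)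
    (huw : inner ℝ u w = 0) :
    MeasurePreserving (fun r : E => ((inner ℝ r u : ℝ), (inner ℝ r w : ℝ))) (stdGaussian E)
      planeGaussian := by
  set L : E →L[ℝ] ℝ × ℝ := (innerSL ℝ u).prod (innerSL ℝ w) with hL
  have hfun : (fun r : E => ((inner ℝ r u : ℝ), (inner ℝ r w : ℝ))) = L := by
    ext r <;> simp [hL, real_inner_comm]
  rw [hfun]
  refine ⟨L.measurable, ?_⟩
  have : IsProbabilityMeasure ((stdGaussian E).map L) :=
    Measure.isProbabilityMeasure_map L.measurable.aemeasurable
  apply Measure.ext_of_charFunDual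
  ext M
  rw [charFunDual_map, charFunDual_stdGaussian, charFunDual_prod]
  set a : ℝ := M (1, 0) with ha
  set b : ℝ := M (0, 1) with hb
  have hM : M.comp L = innerSL ℝ (a • u + b • w) := by
    ext r
    have : L r = (inner ℝ u r : ℝ) • ((1, 0) : ℝ × ℝ) + (inner ℝ w r : ℝ) • ((0, 1) : ℝ × ℝ) := by
      ext <;> simp [hL]
    rw [ContinuousLinearMap.comp_apply, this, map_add, map_smul, map_smul, innerSL_apply_apply,
      inner_add_left, real_inner_smul_left, real_inner_smul_left, smul_eq_mul, smul_eq_mul]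
    ring
  have hnorm : ‖M.comp L‖ ^ 2 = a ^ 2 + b ^ 2 := by
    rw [hM, innerSL_apply_norm, norm_add_sq_real, norm_smul, norm_smul, hu, hw,
      real_inner_smul_left, real_inner_smul_right, huw]
    simp
  have key (N : StrongDual ℝ ℝ) :
      charFunDual (gaussianReal 0 1) N = Complex.exp (-((N 1 : ℝ) : ℂ) ^ 2 / 2) := by
    have h : charFunDual (gaussianReal 0 1) N = charFun (gaussianReal 0 1) (N 1) := by
      rw [charFunDual_apply, charFun_apply_real]
      congr 1
      ext x
      rw [show N x = N 1 * x by rw [mul_comm, ← smul_eq_mul, ← map_smul, smul_eq_mul, mul_one]]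
      push_cast
      rfl
    rw [h, charFun_gaussianReal]
    congr 1
    push_cast
    ring
  rw [key, key, ← Complex.exp_add]
  congr 1
  have : ((‖M.comp L‖ : ℝ) : ℂ) ^ 2 = (a : ℂ) ^ 2 + (b : ℂ) ^ 2 := by exact_mod_cast hnorm
  rw [this]
  simp [ha, hb]
  ring

/-- A pair of Gaussian projections is a linear image of the plane Gaussian. -/
lemma exists_measurePreserving_pair (hdim : 2 ≤ Module.finrank ℝ E) {u v : E} (hu : ‖u‖ = 1)
    (hv : ‖v‖ = 1) :
    ∃ f : E → ℝ × ℝ, MeasurePreserving f (stdGaussian E) planeGaussian ∧ ∀ r,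
      inner ℝ r u = (f r).1 ∧
      inner ℝ r v = Real.cos (Real.arccos (inner ℝ u v)) * (f r).1 +
        Real.sin (Real.arccos (inner ℝ u v)) * (f r).2 := by
  obtain ⟨w, hw, huw, hvw⟩ := exists_orthonormal_decomposition hdim hu hv
  refine ⟨_, measurePreserving_inner_pair hu hw huw, fun r => ⟨rfl, ?_⟩⟩
  conv_lhs => rw [hvw]
  rw [inner_add_right, real_inner_smul_right, real_inner_smul_right]

lemma measurableSet_separate (u v : E) :
    MeasurableSet {r : E | sgn (inner ℝ r u) ≠ sgn (inner ℝ r v)} :=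
  (measurableSet_eq_fun (measurable_sgn.comp (by fun_prop))
    (measurable_sgn.comp (by fun_prop))).compl

lemma measurableSet_small (u : E) (η : ℝ) : MeasurableSet {r : E | |(inner ℝ r u : ℝ)| < η} :=
  measurableSet_lt (by fun_prop) measurable_const

lemma stdGaussian_separate (hdim : 2 ≤ Module.finrank ℝ E) {u v : E} (hu : ‖u‖ = 1)
    (hv : ‖v‖ = 1) :
    Real.arccos (inner ℝ u v) / Real.pi ≤
      (stdGaussian E).real {r | sgn (inner ℝ r u) ≠ sgn (inner ℝ r v)} := by
  obtain ⟨f, hf, hfr⟩ := exists_measurePreserving_pair hdim hu hv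
  have h := planeGaussian_separate (Real.arccos_nonneg (inner ℝ u v))
    (Real.arccos_le_pi (inner ℝ u v))
  have hm : MeasurableSet {p : ℝ × ℝ | sgn p.1 ≠ sgn (Real.cos (Real.arccos (inner ℝ u v)) * p.1 +
      Real.sin (Real.arccos (inner ℝ u v)) * p.2)} :=
    (measurableSet_eq_fun (measurable_sgn.comp measurable_fst)
      (measurable_sgn.comp (measurable_linear _ _))).compl
  rw [← hf.measure_preimage hm.nullMeasurableSet] at h
  rw [measureReal_def, ENNReal.ofReal_le_iff_le_toReal (measure_ne_top _ _)] at *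
  convert h using 3
  ext r
  simp only [Set.mem_ofPred_eq, Set.mem_preimage, (hfr r).1, (hfr r).2]

lemma stdGaussian_small_eq (hdim : 2 ≤ Module.finrank ℝ E) {u : E} (hu : ‖u‖ = 1) (η : ℝ) :
    stdGaussian E {r | |(inner ℝ r u : ℝ)| < η} = gaussianReal 0 1 (Set.Ioo (-η) η) := by
  obtain ⟨f, hf, hfr⟩ := exists_measurePreserving_pair hdim hu hu
  have h := (measurePreserving_fst.comp hf).measure_preimage
    (measurableSet_Ioo (a := -η) (b := η)).nullMeasurableSet
  rw [← h]
  congr 1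
  ext r
  simp only [Set.mem_ofPred_eq, Set.mem_preimage, (hfr r).1, Function.comp, Set.mem_Ioo, abs_lt]

lemma stdGaussian_small_le (hdim : 2 ≤ Module.finrank ℝ E) {u : E} (hu : ‖u‖ = 1) {η : ℝ}
    (hη : 0 ≤ η) : (stdGaussian E).real {r | |(inner ℝ r u : ℝ)| < η} ≤ 4 / 5 * η := by
  rw [measureReal_def, stdGaussian_small_eq hdim hu]
  exact ENNReal.toReal_le_of_le_ofReal (by positivity) gaussianReal_Ioo_neg_le

lemma le_stdGaussian_small (hdim : 2 ≤ Module.finrank ℝ E) {u : E} (hu : ‖u‖ = 1) {η : ℝ}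
    (hη : η ≤ 1 / 2) : 3 / 5 * η ≤ (stdGaussian E).real {r | |(inner ℝ r u : ℝ)| < η} := by
  rw [measureReal_def, stdGaussian_small_eq hdim hu,
    ← ENNReal.ofReal_le_iff_le_toReal (measure_ne_top _ _)]
  exact le_gaussianReal_Ioo_neg hη

lemma stdGaussian_disagree_le (hdim : 2 ≤ Module.finrank ℝ E) {u v : E} (hu : ‖u‖ = 1)
    (hv : ‖v‖ = 1) {κ η τ : ℝ} (hs : 0 < Real.sin (Real.arccos (inner ℝ u v))) (hκ : 0 ≤ κ)
    (hρ : -κ ≤ inner ℝ u v) (hη : 0 ≤ η) (hτ : 0 ≤ τ) :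
    (stdGaussian E).real {r | |(inner ℝ r u : ℝ)| < η ∧ τ ≤ |(inner ℝ r v : ℝ)| ∧
        sgn (inner ℝ r u) ≠ sgn (inner ℝ r v)} ≤
      (stdGaussian E).real {r | |(inner ℝ r u : ℝ)| < η ∧ τ ≤ |(inner ℝ r v : ℝ)| ∧
        sgn (inner ℝ r u) = sgn (inner ℝ r v)} +
        16 / 25 * (κ * η ^ 2 / Real.sin (Real.arccos (inner ℝ u v))) := by
  obtain ⟨f, hf, hfr⟩ := exists_measurePreserving_pair hdim hu hv
  have habs : |(inner ℝ u v : ℝ)| ≤ 1 := by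
    have := abs_real_inner_le_norm u v
    rwa [hu, hv, one_mul] at this
  rw [← Real.cos_arccos (abs_le.1 habs).1 (abs_le.1 habs).2] at hρ
  set c := Real.cos (Real.arccos (inner ℝ u v))
  set s := Real.sin (Real.arccos (inner ℝ u v))
  simp only [(hfr _).1, (hfr _).2]
  have h := planeGaussian_disagree_le hs hκ hρ hη hτ
  have hm0 : MeasurableSet {p : ℝ × ℝ | sgn p.1 = sgn (c * p.1 + s * p.2)} :=
    measurableSet_eq_fun (measurable_sgn.comp measurable_fst)
      (measurable_sgn.comp (measurable_linear _ _))
  have hm1 : MeasurableSet {p : ℝ × ℝ | |p.1| < η} :=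
    measurableSet_lt measurable_fst.abs measurable_const
  have hm2 : MeasurableSet {p : ℝ × ℝ | τ ≤ |c * p.1 + s * p.2|} :=
    measurableSet_le measurable_const (measurable_linear _ _).abs
  have e1 : stdGaussian E {r | |(f r).1| < η ∧ τ ≤ |c * (f r).1 + s * (f r).2| ∧
      sgn (f r).1 = sgn (c * (f r).1 + s * (f r).2)} = planeGaussian {p | |p.1| < η ∧
      τ ≤ |c * p.1 + s * p.2| ∧ sgn p.1 = sgn (c * p.1 + s * p.2)} :=
    hf.measure_preimage (hm1.inter (hm2.inter hm0)).nullMeasurableSet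
  have e2 : stdGaussian E {r | |(f r).1| < η ∧ τ ≤ |c * (f r).1 + s * (f r).2| ∧
      sgn (f r).1 ≠ sgn (c * (f r).1 + s * (f r).2)} = planeGaussian {p | |p.1| < η ∧
      τ ≤ |c * p.1 + s * p.2| ∧ sgn p.1 ≠ sgn (c * p.1 + s * p.2)} :=
    hf.measure_preimage (hm1.inter (hm2.inter hm0.compl)).nullMeasurableSet
  rw [← e1, ← e2] at h
  have herr : 0 ≤ 16 / 25 * (κ * η ^ 2 / s) := by positivity
  have h' := ENNReal.toReal_mono
    (ENNReal.add_ne_top.2 ⟨measure_ne_top _ _, ENNReal.ofReal_ne_top⟩) h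
  rwa [ENNReal.toReal_add (measure_ne_top _ _) ENNReal.ofReal_ne_top,
    ENNReal.toReal_ofReal herr] at h'

/-- The probability that one of the two vertices is resampled and both signs disagree. -/
lemma stdGaussian_resampled_disagree_le (hdim : 2 ≤ Module.finrank ℝ E) {u v : E} (hu : ‖u‖ = 1)
    (hv : ‖v‖ = 1) {κ η : ℝ} (hs : 0 < Real.sin (Real.arccos (inner ℝ u v))) (hκ : 0 ≤ κ)
    (hρ : -κ ≤ inner ℝ u v) (hη : 0 ≤ η) :
    (stdGaussian E).real ({r | |(inner ℝ r u : ℝ)| < η ∨ |(inner ℝ r v : ℝ)| < η} ∩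
        {r | sgn (inner ℝ r u) ≠ sgn (inner ℝ r v)}) ≤
      1 / 2 * (stdGaussian E).real {r | |(inner ℝ r u : ℝ)| < η ∨ |(inner ℝ r v : ℝ)| < η} +
        16 / 25 * (κ * η ^ 2 / Real.sin (Real.arccos (inner ℝ u v))) := by
  -- The threshold `τ = 0` treats all cases with `u` small; exchanging the roles with `τ = η` treats
  -- `v` small and `u` not. These events partition `A`, so the two errors add up, and solving for
  -- the disagreement probability halves their sum.
  have h1 := stdGaussian_disagree_le hdim hu hv hs hκ hρ hη le_rfl
  rw [real_inner_comm] at hρ hs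
  have h2 := stdGaussian_disagree_le hdim hv hu hs hκ hρ hη hη
  rw [real_inner_comm] at h2
  set μ := stdGaussian E
  set A : Set E := {r | |(inner ℝ r u : ℝ)| < η ∨ |(inner ℝ r v : ℝ)| < η}
  set C : Set E := {r | sgn (inner ℝ r u) ≠ sgn (inner ℝ r v)}
  set U : Set E := {r | |(inner ℝ r u : ℝ)| < η}
  have hC : MeasurableSet C := measurableSet_separate u v
  have hU : MeasurableSet U := measurableSet_small u η
  have e1 := measureReal_inter_add_sdiff (μ := μ) (s := A) hC
  have e2 := measureReal_inter_add_sdiff (μ := μ) (s := A ∩ C) hU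
  have e3 := measureReal_inter_add_sdiff (μ := μ) (s := A \ C) hU
  have s1 : {r | |(inner ℝ r u : ℝ)| < η ∧ 0 ≤ |(inner ℝ r v : ℝ)| ∧
      sgn (inner ℝ r u) ≠ sgn (inner ℝ r v)} = A ∩ C ∩ U := by
    ext r; simp only [A, C, U, Set.mem_inter_iff, Set.mem_ofPred_eq, abs_nonneg, true_and]; tauto
  have s2 : {r | |(inner ℝ r u : ℝ)| < η ∧ 0 ≤ |(inner ℝ r v : ℝ)| ∧
      sgn (inner ℝ r u) = sgn (inner ℝ r v)} = A \ C ∩ U := by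
    ext r
    simp only [A, C, U, Set.mem_inter_iff, Set.mem_sdiff, Set.mem_ofPred_eq, abs_nonneg, true_and]
    tauto
  have s3 : {r | |(inner ℝ r v : ℝ)| < η ∧ η ≤ |(inner ℝ r u : ℝ)| ∧
      sgn (inner ℝ r v) ≠ sgn (inner ℝ r u)} = (A ∩ C) \ U := by
    ext r
    simp only [A, C, U, Set.mem_inter_iff, Set.mem_sdiff, Set.mem_ofPred_eq, ← not_lt,
      ne_comm (a := sgn (inner ℝ r u))]
    tauto
  have s4 : {r | |(inner ℝ r v : ℝ)| < η ∧ η ≤ |(inner ℝ r u : ℝ)| ∧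
      sgn (inner ℝ r v) = sgn (inner ℝ r u)} = (A \ C) \ U := by
    ext r
    simp only [A, C, U, Set.mem_sdiff, Set.mem_ofPred_eq, ← not_lt,
      ne_comm (a := sgn (inner ℝ r u)), not_not, ne_eq]
    tauto
  rw [s1, s2] at h1
  rw [s3, s4] at h2
  linarith

end Projection

/-! ### Resampling with fair coins. -/

section Coins

variable {V : Type*} [Fintype V]

/-- The law of the coins. -/
noncomputable abbrev coins (V : Type*) [Fintype V] : Measure (V → Bool) :=
  Measure.pi fun _ : V => (PMF.uniformOfFintype Bool).toMeasure

lemma measurePreserving_not :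
    MeasurePreserving (fun b : Bool => !b) (PMF.uniformOfFintype Bool).toMeasure
      (PMF.uniformOfFintype Bool).toMeasure := by
  refine ⟨measurable_of_finite _, ?_⟩
  refine Measure.ext_of_singleton fun b => ?_
  rw [Measure.map_apply (measurable_of_finite _) (measurableSet_singleton _)]
  have : (fun b : Bool => !b) ⁻¹' {b} = {!b} := by ext c; cases b <;> cases c <;> simp
  rw [this, PMF.toMeasure_apply_singleton _ _ (measurableSet_singleton _),
    PMF.toMeasure_apply_singleton _ _ (measurableSet_singleton _)]
  simp

lemma measurePreserving_flip [DecidableEq V] (u : V) :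
    MeasurePreserving (fun c : V → Bool => Function.update c u (!c u)) (coins V) (coins V) := by
  have h := measurePreserving_pi (fun _ : V => (PMF.uniformOfFintype Bool).toMeasure)
    (fun _ : V => (PMF.uniformOfFintype Bool).toMeasure)
    (f := fun v b => if v = u then !b else b) (fun v => by
      by_cases hv : v = u
      · simpa only [hv, if_true] using measurePreserving_not
      · simp only [hv, if_false]
        exact MeasurePreserving.id _)
  convert h using 1
  ext c v
  by_cases hv : v = u
  · subst hv; simp
  · simp [hv]

/-- Flipping one coin preserves the law and exchanges `S` with its complement. -/
lemma coins_half_of_flip [DecidableEq V] (u : V) {S : Set (V → Bool)}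
    (h : ∀ c, Function.update c u (!c u) ∈ S ↔ c ∉ S) : (coins V).real S = 1 / 2 := by
  have hS : MeasurableSet S := S.toFinite.measurableSet
  have h1 : coins V Sᶜ = coins V S := by
    rw [← (measurePreserving_flip u).measure_preimage hS.nullMeasurableSet]
    congr 1
    ext c
    exact (h c).symm
  have h2 := probReal_compl_eq_one_sub (μ := coins V) hS
  rw [measureReal_def, h1, ← measureReal_def] at h2
  linarith

variable (η : ℝ) (x : V → Space V) (r : Space V)

lemma sign'_of_le {v : V} (c : V → Bool) (h : η ≤ |(inner ℝ r (x v) : ℝ)|) :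
    sign' η x r c v = sign x r v := if_pos h

lemma sign'_of_lt {v : V} (c : V → Bool) (h : |(inner ℝ r (x v) : ℝ)| < η) :
    sign' η x r c v = c v := if_neg (not_le.2 h)

lemma coins_separate_of_lt {u v : V} (huv : u ≠ v) (h : |(inner ℝ r (x u) : ℝ)| < η) :
    (coins V).real {c | sign' η x r c u ≠ sign' η x r c v} = 1 / 2 := by
  classical
  apply coins_half_of_flip u
  intro c
  have hv : sign' η x r (Function.update c u (!c u)) v = sign' η x r c v := by
    unfold sign'
    rw [Function.update_of_ne huv.symm]
  simp only [Set.mem_ofPred_eq]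
  rw [hv, sign'_of_lt _ _ _ _ h, sign'_of_lt _ _ _ _ h, Function.update_self]
  cases c u <;> cases sign' η x r c v <;> simp

lemma coins_separate_of_lt_or {u v : V} (huv : u ≠ v)
    (h : |(inner ℝ r (x u) : ℝ)| < η ∨ |(inner ℝ r (x v) : ℝ)| < η) :
    (coins V).real {c | sign' η x r c u ≠ sign' η x r c v} = 1 / 2 := by
  rcases h with h | h
  · exact coins_separate_of_lt η x r huv h
  · simp_rw [ne_comm (a := sign' η x r _ u)]
    exact coins_separate_of_lt η x r huv.symm h

lemma coins_separate_of_le {u v : V}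
    (h : ¬(|(inner ℝ r (x u) : ℝ)| < η ∨ |(inner ℝ r (x v) : ℝ)| < η)) :
    (coins V).real {c | sign' η x r c u ≠ sign' η x r c v} =
      {r | sgn (inner ℝ r (x u)) ≠ sgn (inner ℝ r (x v))}.indicator (fun _ => (1 : ℝ)) r := by
  push Not at h
  simp_rw [sign'_of_le η x r _ h.1, sign'_of_le η x r _ h.2, sign]
  by_cases hs : sgn (inner ℝ r (x u)) = sgn (inner ℝ r (x v))
  · rw [Set.indicator_of_notMem (by simpa using hs)]
    simp [hs]
  · rw [Set.indicator_of_mem (by simpa using hs)]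
    simp [hs]

lemma measurable_sign (v : V) : Measurable fun ω : Space V × (V → Bool) => sign x ω.1 v :=
  measurable_sgn.comp (by fun_prop)

lemma measurable_sign' (v : V) :
    Measurable fun ω : Space V × (V → Bool) => sign' η x ω.1 ω.2 v := by
  unfold sign'
  refine Measurable.ite (measurableSet_le measurable_const (by fun_prop)) (measurable_sign x v) ?_
  exact (measurable_pi_apply v).comp measurable_snd

instance : IsProbabilityMeasure (randomness V) := by
  unfold randomness; infer_instance

/-- The probability that the perturbed signs of two vertices disagree. -/
lemma randomness_separate' {u v : V} (huv : u ≠ v) :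
    (randomness V).real {ω | sign' η x ω.1 ω.2 u ≠ sign' η x ω.1 ω.2 v} =
      1 / 2 * (stdGaussian (Space V)).real
          {r | |(inner ℝ r (x u) : ℝ)| < η ∨ |(inner ℝ r (x v) : ℝ)| < η} +
        (stdGaussian (Space V)).real ({r | sgn (inner ℝ r (x u)) ≠ sgn (inner ℝ r (x v))} \
          {r | |(inner ℝ r (x u) : ℝ)| < η ∨ |(inner ℝ r (x v) : ℝ)| < η}) := by
  set A : Set (Space V) := {r | |(inner ℝ r (x u) : ℝ)| < η ∨ |(inner ℝ r (x v) : ℝ)| < η}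
  set C : Set (Space V) := {r | sgn (inner ℝ r (x u)) ≠ sgn (inner ℝ r (x v))}
  have hA : MeasurableSet A := (measurableSet_small (x u) η).union (measurableSet_small (x v) η)
  have hC : MeasurableSet C := measurableSet_separate _ _
  have hS : MeasurableSet {ω : Space V × (V → Bool) |
      sign' η x ω.1 ω.2 u ≠ sign' η x ω.1 ω.2 v} :=
    (measurableSet_eq_fun (measurable_sign' η x u) (measurable_sign' η x v)).compl
  have hint : (randomness V).real {ω | sign' η x ω.1 ω.2 u ≠ sign' η x ω.1 ω.2 v} =
      ∫ r, (coins V).real (Prod.mk r ⁻¹' {ω : Space V × (V → Bool) |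
        sign' η x ω.1 ω.2 u ≠ sign' η x ω.1 ω.2 v}) ∂stdGaussian (Space V) := by
    simp only [measureReal_def]
    rw [randomness, integral_toReal (measurable_measure_prodMk_left hS).aemeasurable
      (ae_of_all _ fun r => measure_lt_top _ _), Measure.prod_apply hS]
  rw [hint]
  -- Conditionally on `r`, a resampled pair is separated with probability `1/2`, and otherwise the
  -- outcome is already determined by `r`.
  have h : ∀ r, (coins V).real (Prod.mk r ⁻¹' {ω : Space V × (V → Bool) |
      sign' η x ω.1 ω.2 u ≠ sign' η x ω.1 ω.2 v}) =
      A.indicator (fun _ => (1 / 2 : ℝ)) r + (C \ A).indicator (fun _ => (1 : ℝ)) r := by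
    intro r
    change (coins V).real {c | sign' η x r c u ≠ sign' η x r c v} = _
    by_cases hr : r ∈ A
    · rw [Set.indicator_of_mem hr, Set.indicator_of_notMem (fun h => h.2 hr), add_zero]
      exact coins_separate_of_lt_or η x r huv hr
    · rw [Set.indicator_of_notMem hr, zero_add, coins_separate_of_le η x r hr]
      by_cases hc : r ∈ C
      · rw [Set.indicator_of_mem hc, Set.indicator_of_mem (show r ∈ C \ A from ⟨hc, hr⟩)]
      · rw [Set.indicator_of_notMem hc, Set.indicator_of_notMem (fun h => hc h.1)]
  simp_rw [h]
  rw [integral_add ((integrable_const _).indicator hA) ((integrable_const _).indicator (hC.diff hA)),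
    integral_indicator_const _ hA, integral_indicator_const _ (hC.diff hA)]
  simp [mul_comm]

end Coins

/-! ### Lower bounds for the probability that an edge is cut. -/

section Edge

variable {V : Type*} [Fintype V] {x : V → Space V} {u v : V} {η : ℝ}

lemma two_le_finrank_space (huv : u ≠ v) : 2 ≤ Module.finrank ℝ (Space V) := by
  rw [finrank_euclideanSpace_fin]
  exact Fintype.one_lt_card_iff.2 ⟨u, v, huv⟩

lemma randomness_separate (huv : u ≠ v) (hu : ‖x u‖ = 1) (hv : ‖x v‖ = 1) :
    Real.arccos (inner ℝ (x u) (x v)) / Real.pi ≤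
      (randomness V).real {ω | sign x ω.1 u ≠ sign x ω.1 v} := by
  have h := stdGaussian_separate (two_le_finrank_space huv) hu hv
  rwa [← (measurePreserving_fst (μ := stdGaussian (Space V)) (ν := coins V)).measureReal_preimage
    (measurableSet_separate _ _).nullMeasurableSet] at h

/-- Half the probability of resampling `u` alone is already enough. The bound does not depend on the
angle, so it is useful for nearly parallel vectors. -/
lemma randomness_separate'_ge_of_small (huv : u ≠ v) (hu : ‖x u‖ = 1) (hη : η ≤ 1 / 2) :
    3 / 10 * η ≤ (randomness V).real {ω | sign' η x ω.1 ω.2 u ≠ sign' η x ω.1 ω.2 v} := by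
  rw [randomness_separate' η x huv]
  have h1 := le_stdGaussian_small (two_le_finrank_space huv) hu hη
  have h2 : (stdGaussian (Space V)).real {r | |(inner ℝ r (x u) : ℝ)| < η} ≤
      (stdGaussian (Space V)).real
        {r | |(inner ℝ r (x u) : ℝ)| < η ∨ |(inner ℝ r (x v) : ℝ)| < η} :=
    measureReal_mono fun r hr => Or.inl hr
  have h3 := measureReal_nonneg (μ := stdGaussian (Space V))
    (s := {r | sgn (inner ℝ r (x u)) ≠ sgn (inner ℝ r (x v))} \
          {r | |(inner ℝ r (x u) : ℝ)| < η ∨ |(inner ℝ r (x v) : ℝ)| < η})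
  linarith

lemma arccos_le_diff_add (huv : u ≠ v) (hu : ‖x u‖ = 1) (hv : ‖x v‖ = 1) (η : ℝ) :
    Real.arccos (inner ℝ (x u) (x v)) / Real.pi ≤
      (stdGaussian (Space V)).real ({r | sgn (inner ℝ r (x u)) ≠ sgn (inner ℝ r (x v))} \
          {r | |(inner ℝ r (x u) : ℝ)| < η ∨ |(inner ℝ r (x v) : ℝ)| < η}) +
      (stdGaussian (Space V)).real
        ({r | |(inner ℝ r (x u) : ℝ)| < η ∨ |(inner ℝ r (x v) : ℝ)| < η} ∩
          {r | sgn (inner ℝ r (x u)) ≠ sgn (inner ℝ r (x v))}) := by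
  have h1 := stdGaussian_separate (two_le_finrank_space huv) hu hv
  have h2 := measureReal_inter_add_sdiff (μ := stdGaussian (Space V))
    (s := {r | sgn (inner ℝ r (x u)) ≠ sgn (inner ℝ r (x v))})
    ((measurableSet_small (x u) η).union (measurableSet_small (x v) η))
  rw [Set.inter_comm] at h2
  exact h1.trans (le_of_eq (by rw [← h2, add_comm]; rfl))

lemma randomness_separate'_ge_of_sin_pos (huv : u ≠ v) (hu : ‖x u‖ = 1) (hv : ‖x v‖ = 1)
    {κ : ℝ} (hs : 0 < Real.sin (Real.arccos (inner ℝ (x u) (x v)))) (hκ : 0 ≤ κ)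
    (hρ : -κ ≤ inner ℝ (x u) (x v)) (hη : 0 ≤ η) :
    Real.arccos (inner ℝ (x u) (x v)) / Real.pi -
        16 / 25 * (κ * η ^ 2 / Real.sin (Real.arccos (inner ℝ (x u) (x v)))) ≤
      (randomness V).real {ω | sign' η x ω.1 ω.2 u ≠ sign' η x ω.1 ω.2 v} := by
  rw [randomness_separate' η x huv]
  have h1 := arccos_le_diff_add huv hu hv η
  have h2 := stdGaussian_resampled_disagree_le (two_le_finrank_space huv) hu hv hs hκ hρ hη
  linarith

/-- A union bound on the resampling event, half of which is recovered by the coins. It serves angles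
near `π`, where the second-order bound degenerates with the sine. -/
lemma randomness_separate'_ge (huv : u ≠ v) (hu : ‖x u‖ = 1) (hv : ‖x v‖ = 1) (hη : 0 ≤ η) :
    Real.arccos (inner ℝ (x u) (x v)) / Real.pi - 4 / 5 * η ≤
      (randomness V).real {ω | sign' η x ω.1 ω.2 u ≠ sign' η x ω.1 ω.2 v} := by
  rw [randomness_separate' η x huv]
  have h1 := arccos_le_diff_add huv hu hv η
  have h2 := stdGaussian_small_le (two_le_finrank_space huv) hu hη
  have h3 := stdGaussian_small_le (two_le_finrank_space huv) hv hη
  have h4 := measureReal_union_le (μ := stdGaussian (Space V))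
    {r | |(inner ℝ r (x u) : ℝ)| < η} {r | |(inner ℝ r (x v) : ℝ)| < η}
  have h5 : (stdGaussian (Space V)).real
        ({r | |(inner ℝ r (x u) : ℝ)| < η ∨ |(inner ℝ r (x v) : ℝ)| < η} ∩
          {r | sgn (inner ℝ r (x u)) ≠ sgn (inner ℝ r (x v))}) ≤
      (stdGaussian (Space V)).real
        {r | |(inner ℝ r (x u) : ℝ)| < η ∨ |(inner ℝ r (x v) : ℝ)| < η} :=
    measureReal_mono Set.inter_subset_left
  rw [show {r : Space V | |(inner ℝ r (x u) : ℝ)| < η} ∪ {r | |(inner ℝ r (x v) : ℝ)| < η} =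
    {r | |(inner ℝ r (x u) : ℝ)| < η ∨ |(inner ℝ r (x v) : ℝ)| < η} from rfl] at h4
  linarith

end Edge

/-! ### Numerical bounds around the Goemans-Williamson constant. -/

section Alpha

lemma one_sub_cos_pos {θ : ℝ} (hθ : θ ∈ Set.Ioc 0 Real.pi) : 0 < 1 - Real.cos θ := by
  have := Real.cos_lt_cos_of_nonneg_of_le_pi le_rfl hθ.2 hθ.1
  rw [Real.cos_zero] at this
  linarith

lemma alphaGW_image_nonneg {y : ℝ} (hy : y ∈ (fun θ : ℝ =>
    2 / Real.pi * (θ / (1 - Real.cos θ))) '' Set.Ioc 0 Real.pi) : 0 ≤ y := by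
  obtain ⟨θ, hθ, rfl⟩ := hy
  have := one_sub_cos_pos hθ
  have := hθ.1
  positivity

lemma alphaGW_nonneg : 0 ≤ alphaGW := Real.sInf_nonneg fun _ => alphaGW_image_nonneg

lemma alphaGW_le {θ : ℝ} (hθ : θ ∈ Set.Ioc 0 Real.pi) :
    alphaGW ≤ 2 / Real.pi * (θ / (1 - Real.cos θ)) :=
  csInf_le ⟨0, fun _ => alphaGW_image_nonneg⟩ ⟨θ, hθ, rfl⟩

lemma alphaGW_mul_le {θ : ℝ} (h0 : 0 ≤ θ) (hπ : θ ≤ Real.pi) :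
    alphaGW * ((1 - Real.cos θ) / 2) ≤ θ / Real.pi := by
  rcases h0.eq_or_lt with rfl | h0
  · simp
  · have h1 := one_sub_cos_pos ⟨h0, hπ⟩
    calc alphaGW * ((1 - Real.cos θ) / 2)
        ≤ 2 / Real.pi * (θ / (1 - Real.cos θ)) * ((1 - Real.cos θ) / 2) := by
          gcongr; exact alphaGW_le ⟨h0, hπ⟩
      _ = θ / Real.pi := by field_simp

lemma alphaGW_le_numeral : alphaGW ≤ 0.8787 := by
  have hπ := Real.pi_pos
  -- The angle `3π/4` is close to the minimizer and has an explicit cosine.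
  have h := alphaGW_le (θ := 3 * Real.pi / 4) ⟨by positivity, by linarith⟩
  rw [show 3 * Real.pi / 4 = Real.pi - Real.pi / 4 by ring, Real.cos_pi_sub,
    Real.cos_pi_div_four] at h
  have h2 : (1.4142 : ℝ) ≤ √2 := Real.le_sqrt_of_sq_le (by norm_num)
  refine h.trans ?_
  rw [show 2 / Real.pi * ((Real.pi - Real.pi / 4) / (1 - -(√2 / 2))) = 1.5 / (1 + √2 / 2) by
    have : 2 + √2 ≠ 0 := by positivity
    field_simp; ring_nf; field_simp; ring, div_le_iff₀ (by positivity)]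
  linarith

/-- The maximum of `(1 - cos θ) / θ` on `(0, π]` is about `0.7246`, attained beyond `2π/3`; the room
below it produces the strict gain. A chord bound suffices up to `π/2`, and a Taylor bound for the
sine afterwards. -/
lemma one_sub_cos_le {θ : ℝ} (h0 : 0 ≤ θ) (h : θ ≤ 2 * Real.pi / 3) :
    1 - Real.cos θ ≤ 0.721 * θ := by
  have hπ1 := Real.pi_gt_d4
  have hπ2 := Real.pi_lt_d4
  rcases le_total θ (Real.pi / 2) with h1 | h1
  · have h2 := Real.one_sub_mul_le_cos h0 h1
    have h3 : 2 / Real.pi * θ ≤ 0.721 * θ := by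
      gcongr
      rw [div_le_iff₀ Real.pi_pos]
      linarith
    linarith
  · set z := θ - Real.pi / 2 with hz
    have hz0 : 0 ≤ z := by linarith
    have hz1 : z ≤ 0.524 := by linarith
    have hcos : Real.cos θ = -Real.sin z := by
      rw [hz, Real.sin_sub_pi_div_two, neg_neg]
    have hb := (abs_le.1 (Real.sin_bound (x := z) (by rw [abs_of_nonneg hz0]; linarith))).2
    rw [abs_of_nonneg hz0] at hb
    have hz3 : 0 ≤ z ^ 3 := by positivity
    have hz5 : z ^ 5 ≤ z ^ 3 * 0.275 := by
      have : z ^ 2 ≤ 0.275 := by nlinarith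
      calc z ^ 5 = z ^ 3 * z ^ 2 := by ring
        _ ≤ _ := by gcongr
    -- Tangent to the cube at `1/2`, near the right end of the range of `z`, where the inequality is
    -- tight.
    have ht : 0.75 * z - 0.25 ≤ z ^ 3 := by
      have : z ^ 3 - (0.75 * z - 0.25) = (z - 0.5) ^ 2 * (z + 1) := by ring
      nlinarith [mul_nonneg (sq_nonneg (z - 0.5)) (by linarith : (0 : ℝ) ≤ z + 1)]
    have hθ : θ = z + Real.pi / 2 := by rw [hz]; ring
    rw [hcos, hθ]
    linarith

/-- Up to the angle `2π/3`, hyperplane rounding is better than the worst case. -/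
lemma alphaGW_mul_add_le {θ : ℝ} (h0 : 0 ≤ θ) (h : θ ≤ 2 * Real.pi / 3) :
    alphaGW * ((1 - Real.cos θ) / 2) + 0.0015 * θ ≤ θ / Real.pi := by
  have h1 : alphaGW * ((1 - Real.cos θ) / 2) ≤ 0.8787 * (0.721 * θ / 2) := by
    have := one_sub_cos_le h0 h
    have h2 := Real.cos_le_one θ
    exact mul_le_mul alphaGW_le_numeral (by linarith) (by linarith) (by norm_num)
  have h3 : 0.31828 * θ ≤ θ / Real.pi := by
    rw [le_div_iff₀ Real.pi_pos]
    nlinarith [Real.pi_lt_d4]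
  linarith

end Alpha

/-! ### Gain or loss of a single edge against the benchmark. -/

section EdgeExcess

variable {V : Type*} [Fintype V] {x : V → Space V} {u v : V} {η : ℝ}

lemma abs_inner_le_one (hu : ‖x u‖ = 1) (hv : ‖x v‖ = 1) :
    |(inner ℝ (x u) (x v) : ℝ)| ≤ 1 := by
  have := abs_real_inner_le_norm (x u) (x v)
  rwa [hu, hv, one_mul] at this

lemma randomness_separate_ge_alphaGW (huv : u ≠ v) (hu : ‖x u‖ = 1) (hv : ‖x v‖ = 1) :
    alphaGW * ((1 - inner ℝ (x u) (x v)) / 2) ≤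
      (randomness V).real {ω | sign x ω.1 u ≠ sign x ω.1 v} := by
  have habs := abs_le.1 (abs_inner_le_one hu hv)
  have h := alphaGW_mul_le (Real.arccos_nonneg (inner ℝ (x u) (x v))) (Real.arccos_le_pi _)
  rw [Real.cos_arccos habs.1 habs.2] at h
  exact h.trans (randomness_separate huv hu hv)

lemma randomness_separate'_ge_of_arccos_le (huv : u ≠ v) (hu : ‖x u‖ = 1) (hv : ‖x v‖ = 1)
    (hη : 0 ≤ η) (h0 : 0 < Real.arccos (inner ℝ (x u) (x v)))
    (h : Real.arccos (inner ℝ (x u) (x v)) ≤ 9 / 10 * Real.pi) :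
    Real.arccos (inner ℝ (x u) (x v)) / Real.pi - 4 * η ^ 2 ≤
      (randomness V).real {ω | sign' η x ω.1 ω.2 u ≠ sign' η x ω.1 ω.2 v} := by
  have habs := abs_le.1 (abs_inner_le_one hu hv)
  have hcos := Real.cos_arccos habs.1 habs.2
  set ρ : ℝ := inner ℝ (x u) (x v) with hρ
  set θ := Real.arccos ρ
  have hπ := Real.pi_pos
  have hs : 0 < Real.sin θ := Real.sin_pos_of_pos_of_lt_pi h0 (by linarith)
  rcases le_total 0 ρ with hρ0 | hρ0
  -- For nonnegative correlation the error vanishes, so a small sine at small angles does no harm.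
  · have := randomness_separate'_ge_of_sin_pos (κ := 0) huv hu hv hs le_rfl (by linarith) hη
    rw [zero_mul, zero_div, mul_zero, sub_zero] at this
    exact le_trans (by linarith [sq_nonneg η]) this
  · have := randomness_separate'_ge_of_sin_pos (κ := 1) huv hu hv hs zero_le_one habs.1 hη
    refine le_trans (sub_le_sub_left ?_ _) this
    have hθ : Real.pi / 2 ≤ θ := by
      by_contra hlt
      have := Real.cos_pos_of_mem_Ioo (x := θ) ⟨by linarith, not_le.1 hlt⟩
      linarith
    -- Jordan's inequality at `π - θ ≥ π / 10`. The resulting error is `16/25 · 5 η² = 3.2 η²`.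
    have hs5 : 1 / 5 ≤ Real.sin θ := by
      have h1 := Real.mul_le_sin (x := Real.pi - θ) (by linarith) (by linarith)
      rw [Real.sin_pi_sub] at h1
      refine le_trans ?_ h1
      calc (1 / 5 : ℝ) = 2 / Real.pi * (Real.pi / 10) := by field_simp; norm_num
        _ ≤ _ := by gcongr; linarith
    have : 1 * η ^ 2 / Real.sin θ ≤ 5 * η ^ 2 := by
      rw [div_le_iff₀ hs]
      nlinarith [sq_nonneg η]
    nlinarith [sq_nonneg η]

/-- Four ranges of the angle: up to `η` the coins win; up to `2π/3` the surplus `0.0015 θ` absorbs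
the loss `4 η² ≤ 0.0004 η`; up to `9π/10` only that loss remains; beyond, `0.9` against `0.8787`
covers even a loss linear in `η`. -/
lemma le_randomness_separate' (huv : u ≠ v) (hu : ‖x u‖ = 1) (hv : ‖x v‖ = 1)
    (hη : 0 < η) (hη1 : η ≤ 1 / 10 ^ 4) :
    alphaGW * ((1 - inner ℝ (x u) (x v)) / 2) +
        (if -(1 / 2) ≤ (inner ℝ (x u) (x v) : ℝ) then η / 1000 else -(4 * η ^ 2)) ≤
      (randomness V).real {ω | sign' η x ω.1 ω.2 u ≠ sign' η x ω.1 ω.2 v} := by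
  have habs := abs_le.1 (abs_inner_le_one hu hv)
  have hcos := Real.cos_arccos habs.1 habs.2
  have hq := randomness_separate'_ge_of_arccos_le huv hu hv hη.le
  have hq2 := randomness_separate'_ge huv hu hv hη.le
  have h0 := Real.arccos_nonneg (inner ℝ (x u) (x v))
  have hle := Real.arccos_le_pi (inner ℝ (x u) (x v))
  set ρ : ℝ := inner ℝ (x u) (x v) with hρ
  set θ := Real.arccos ρ
  have hπ := Real.pi_pos
  have hα := alphaGW_nonneg
  have hα1 := alphaGW_le_numeral
  have hηsq : 4 * η ^ 2 ≤ 0.0004 * η := by nlinarith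
  split_ifs with hif
  · have hθ : θ ≤ 2 * Real.pi / 3 := by
      by_contra hlt
      have h1 := Real.cos_lt_cos_of_nonneg_of_le_pi (by positivity) hle (not_le.1 hlt)
      rw [show 2 * Real.pi / 3 = Real.pi - Real.pi / 3 by ring, Real.cos_pi_sub,
        Real.cos_pi_div_three] at h1
      linarith
    rcases le_or_gt θ η with hθη | hθη
    · have h1 := randomness_separate'_ge_of_small (v := v) huv hu (η := η) (by linarith)
      have h2 : 1 - ρ ≤ η ^ 2 / 2 := by
        have h3 := Real.one_sub_sq_div_two_le_cos (x := θ)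
        have h4 : θ ^ 2 ≤ η ^ 2 := by gcongr
        linarith
      have h3 : alphaGW * ((1 - ρ) / 2) ≤ 1 * (η ^ 2 / 4) := by
        apply mul_le_mul <;> linarith
      linarith
    · have h1 := hq (hη.trans hθη) (by linarith)
      have h2 := alphaGW_mul_add_le h0 hθ
      rw [hcos] at h2
      linarith
  · rw [not_le] at hif
    rcases le_or_gt θ (9 / 10 * Real.pi) with hθ | hθ
    · have h1 := alphaGW_mul_le h0 hle
      rw [hcos] at h1
      have hθ0 : 0 < θ := Real.arccos_pos.2 (by linarith)
      linarith [hq hθ0 hθ]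
    · have h1 : 9 / 10 ≤ θ / Real.pi := by
        rw [le_div_iff₀ hπ]; exact hθ.le
      have h2 : alphaGW * ((1 - ρ) / 2) ≤ 0.8787 * 1 := by
        apply mul_le_mul <;> linarith
      linarith [sq_nonneg η]

end EdgeExcess

/-! ### Summation over edges, the SDP relaxation and triangle packings. -/

section Cuts

variable {V : Type*} [Fintype V]

/-- Expanding `‖a + b + c‖² ≥ 0` shows that the three inner products sum to at least `-3/2`. -/
lemma exists_inner_ge_of_unit {a b c : Space V} (ha : ‖a‖ = 1) (hb : ‖b‖ = 1) (hc : ‖c‖ = 1) :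
    -(1 / 2) ≤ (inner ℝ a b : ℝ) ∨ -(1 / 2) ≤ (inner ℝ b c : ℝ) ∨
      -(1 / 2) ≤ (inner ℝ c a : ℝ) := by
  have h := sq_nonneg ‖a + b + c‖
  rw [norm_add_sq_real, norm_add_sq_real, inner_add_left, ha, hb, hc, real_inner_comm c a] at h
  by_contra hcon
  push Not at hcon
  linarith [hcon.1, hcon.2.1, hcon.2.2]

lemma measurable_signs (x : V → Space V) :
    Measurable fun (ω : Space V × (V → Bool)) (v : V) => sign x ω.1 v :=
  measurable_pi_lambda _ fun v => measurable_sign x v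

lemma measurable_signs' (η : ℝ) (x : V → Space V) :
    Measurable fun (ω : Space V × (V → Bool)) (v : V) => sign' η x ω.1 ω.2 v :=
  measurable_pi_lambda _ fun v => measurable_sign' η x v

/-- The contribution of an edge to the objective of the semidefinite program. -/
noncomputable def edgeValue (x : V → Space V) (e : Sym2 V) : ℝ :=
  e.lift ⟨fun u v => (1 - inner ℝ (x u) (x v)) / 2, fun u v => by simp only [real_inner_comm]⟩

lemma sdpValue_eq_sum (G : SimpleGraph V) [DecidableRel G.Adj] (x : V → Space V) :
    sdpValue G x = ∑ e ∈ G.edgeFinset, edgeValue x e := by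
  rw [sdpValue, Finset.mul_sum]
  refine Finset.sum_congr rfl fun e _ => ?_
  induction e using Sym2.ind with
  | _ u v => simp only [edgeValue, Sym2.lift_mk]; ring

variable [DecidableEq V] (G : SimpleGraph V) [DecidableRel G.Adj]

/-- The set of vertices of sign `true`. -/
abbrev side (b : V → Bool) : Finset V := Finset.univ.filter fun v => b v = true

lemma mem_cut_iff {S : Finset V} {u v : V} (h : s(u, v) ∈ G.edgeFinset) :
    s(u, v) ∈ cut G S ↔ ¬(u ∈ S ↔ v ∈ S) := by
  rw [cut, Finset.mem_filter, and_iff_right h]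
  constructor
  · rintro ⟨a, b, hab, ha, hb⟩
    rcases Sym2.eq_iff.1 hab with ⟨rfl, rfl⟩ | ⟨rfl, rfl⟩ <;> tauto
  · intro hne
    by_cases hu : u ∈ S
    · exact ⟨u, v, rfl, hu, by tauto⟩
    · exact ⟨v, u, Sym2.eq_swap, by tauto, hu⟩

lemma mem_cut_side_iff {b : V → Bool} {u v : V} (h : s(u, v) ∈ G.edgeFinset) :
    s(u, v) ∈ cut G (side b) ↔ b u ≠ b v := by
  rw [mem_cut_iff G h]
  simp only [side, Finset.mem_filter, Finset.mem_univ, true_and, ne_eq]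
  exact not_congr Bool.eq_iff_iff.symm

lemma card_cut_eq_sum (S : Finset V) :
    ((cut G S).card : ℝ) = ∑ e ∈ G.edgeFinset, if e ∈ cut G S then (1 : ℝ) else 0 := by
  have hsub : cut G S ⊆ G.edgeFinset := Finset.filter_subset _ _
  rw [Finset.sum_ite_mem, Finset.inter_eq_right.2 hsub, Finset.sum_const, nsmul_eq_mul, mul_one]

lemma integral_card_cut {Ω : Type*} [MeasurableSpace Ω] (μ : Measure Ω) [IsProbabilityMeasure μ]
    {b : Ω → V → Bool} (hb : Measurable b) :
    Integrable (fun ω => ((cut G (side (b ω))).card : ℝ)) μ ∧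
    ∫ ω, ((cut G (side (b ω))).card : ℝ) ∂μ =
      ∑ e ∈ G.edgeFinset, μ.real {ω | e ∈ cut G (side (b ω))} := by
  have hm : ∀ e, MeasurableSet {ω | e ∈ cut G (side (b ω))} := fun e =>
    hb (MeasurableSet.of_discrete (s := {c : V → Bool | e ∈ cut G (side c)}))
  have hi : ∀ e, (fun ω => if e ∈ cut G (side (b ω)) then (1 : ℝ) else 0) =
      {ω | e ∈ cut G (side (b ω))}.indicator fun _ => (1 : ℝ) := by
    intro e; ext ω; simp only [Set.indicator, Set.mem_ofPred_eq]
  have hint : ∀ e, Integrable (fun ω => if e ∈ cut G (side (b ω)) then (1 : ℝ) else 0) μ := by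
    intro e
    rw [hi e]
    exact (integrable_const _).indicator (hm e)
  simp_rw [card_cut_eq_sum]
  refine ⟨integrable_finsetSum _ fun e _ => hint e, ?_⟩
  rw [integral_finsetSum _ fun e _ => hint e]
  refine Finset.sum_congr rfl fun e _ => ?_
  rw [hi e, integral_indicator_const _ (hm e), smul_eq_mul, mul_one]

lemma exists_card_cut_eq_mc : ∃ S, (cut G S).card = mc G := by
  obtain ⟨S, -, hS⟩ := Finset.exists_mem_eq_sup Finset.univ Finset.univ_nonempty
    (fun S => (cut G S).card)
  exact ⟨S, hS.symm⟩

lemma mc_le_card_edgeFinset : mc G ≤ G.edgeFinset.card :=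
  Finset.sup_le fun _ _ => Finset.card_filter_le _ _

variable {G} in
-- A maximum cut gives the feasible point `±z` for a unit vector `z`. Graphs without edges are
-- separated off because the space may then be trivial.
lemma mc_le_sdpValue {x : V → Space V} (hx : IsSDPOptimal G x) : (mc G : ℝ) ≤ sdpValue G x := by
  rcases G.edgeFinset.eq_empty_or_nonempty with h | ⟨e, he⟩
  · have := mc_le_card_edgeFinset G
    rw [h, Finset.card_empty, Nat.le_zero] at this
    rw [this, sdpValue_eq_sum, h, Finset.sum_empty, Nat.cast_zero]
  · have hV : Nonempty V := ⟨e.out.1⟩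
    have : Nontrivial (Space V) := by
      apply Module.nontrivial_of_finrank_pos (R := ℝ)
      rw [finrank_euclideanSpace_fin]
      exact Fintype.card_pos
    obtain ⟨z, hz⟩ := exists_norm_eq (Space V) zero_le_one
    obtain ⟨S, hS⟩ := exists_card_cut_eq_mc G
    set y : V → Space V := fun v => if v ∈ S then z else -z with hy
    have hyf : y ∈ sdpFeasible V := by
      intro v
      rw [mem_sphere_zero_iff_norm]
      by_cases hv : v ∈ S <;> simp [hy, hv, hz]
    refine le_trans (le_of_eq ?_) (hx.2 hyf)
    rw [← hS, card_cut_eq_sum, sdpValue_eq_sum]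
    refine Finset.sum_congr rfl fun e he => ?_
    induction e using Sym2.ind with
    | _ u v =>
      simp only [mem_cut_iff G he, edgeValue, Sym2.lift_mk, hy]
      by_cases hu : u ∈ S <;> by_cases hv : v ∈ S <;>
        simp [hu, hv, hz]

/-- Edge-disjoint triangles contain as many edges at angle at most `2π/3`. -/
lemma le_card_edgeValue_le {x : V → Space V} (hx : x ∈ sdpFeasible V) {k : ℕ}
    (hk : HasTrianglePacking G k) :
    k ≤ (G.edgeFinset.filter fun e => edgeValue x e ≤ 3 / 4).card := by
  obtain ⟨P, rfl, hP, hdisj⟩ := hk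
  have hunit : ∀ v, ‖x v‖ = 1 := fun v => mem_sphere_zero_iff_norm.1 (hx v)
  have hex : ∀ T ∈ P, ∃ e ∈ G.edgeFinset.filter (fun e => edgeValue x e ≤ 3 / 4), e ∈ T := by
    intro T hT
    obtain ⟨u, v, w, h1, h2, h3, rfl⟩ := hP T hT
    simp only [Finset.mem_filter, SimpleGraph.mem_edgeFinset]
    rcases exists_inner_ge_of_unit (hunit u) (hunit v) (hunit w) with h | h | h
    · exact ⟨s(u, v), ⟨h1, by simp only [edgeValue, Sym2.lift_mk]; linarith⟩, by simp⟩
    · exact ⟨s(v, w), ⟨h2, by simp only [edgeValue, Sym2.lift_mk]; linarith⟩, by simp⟩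
    · exact ⟨s(w, u), ⟨h3, by simp only [edgeValue, Sym2.lift_mk]; linarith⟩, by simp⟩
  rcases P.eq_empty_or_nonempty with rfl | ⟨T₀, hT₀⟩
  · simp
  obtain ⟨e₀, -⟩ := hex T₀ hT₀
  have : Nonempty (Sym2 V) := ⟨e₀⟩
  choose! f hf1 hf2 using hex
  -- Edges chosen from disjoint triangles are distinct.
  refine Finset.card_le_card_of_injOn f (fun T hT => hf1 T hT) fun T hT T' hT' heq => ?_
  by_contra hne
  exact Finset.disjoint_left.1 (hdisj hT hT' hne) (hf2 T hT) (heq ▸ hf2 T' hT')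

lemma card_perturbGW (η : ℝ) (x : V → Space V) (ω : Space V × (V → Bool)) :
    (perturbGW G η x ω).card =
      max (cut G (side fun v => sign x ω.1 v)).card
        (cut G (side fun v => sign' η x ω.1 ω.2 v)).card := by
  simp only [perturbGW, side]
  split_ifs with h
  · exact (max_eq_right h.le).symm
  · exact (max_eq_left (not_lt.1 h)).symm

lemma integrable_perturbGW (η : ℝ) (x : V → Space V) :
    Integrable (fun ω => ((perturbGW G η x ω).card : ℝ)) (randomness V) := by
  simp_rw [card_perturbGW, Nat.cast_max]
  exact (integral_card_cut G _ (measurable_signs x)).1.sup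
    (integral_card_cut G _ (measurable_signs' η x)).1

lemma sum_separate_le_integral (η : ℝ) (x : V → Space V) :
    ∑ e ∈ G.edgeFinset, (randomness V).real {ω | e ∈ cut G (side fun v => sign x ω.1 v)} ≤
      ∫ ω, ((perturbGW G η x ω).card : ℝ) ∂randomness V := by
  obtain ⟨h1, h2⟩ := integral_card_cut G (randomness V) (measurable_signs x)
  rw [← h2]
  refine integral_mono h1 (integrable_perturbGW G η x) fun ω => ?_
  simp only [card_perturbGW, Nat.cast_max]
  exact le_max_left _ _

lemma sum_separate'_le_integral (η : ℝ) (x : V → Space V) :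
    ∑ e ∈ G.edgeFinset,
        (randomness V).real {ω | e ∈ cut G (side fun v => sign' η x ω.1 ω.2 v)} ≤
      ∫ ω, ((perturbGW G η x ω).card : ℝ) ∂randomness V := by
  obtain ⟨h1, h2⟩ := integral_card_cut G (randomness V) (measurable_signs' η x)
  rw [← h2]
  refine integral_mono h1 (integrable_perturbGW G η x) fun ω => ?_
  simp only [card_perturbGW, Nat.cast_max]
  exact le_max_right _ _

variable {G} {x : V → Space V}

/-- The guarantee of Goemans and Williamson. -/
lemma alphaGW_mul_sdpValue_le (hx : x ∈ sdpFeasible V) (η : ℝ) :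
    alphaGW * sdpValue G x ≤ ∫ ω, ((perturbGW G η x ω).card : ℝ) ∂randomness V := by
  refine le_trans ?_ (sum_separate_le_integral G η x)
  rw [sdpValue_eq_sum, Finset.mul_sum]
  refine Finset.sum_le_sum fun e he => ?_
  have hunit : ∀ v, ‖x v‖ = 1 := fun v => mem_sphere_zero_iff_norm.1 (hx v)
  induction e using Sym2.ind with
  | _ u v =>
    simp only [mem_cut_side_iff G he]
    exact randomness_separate_ge_alphaGW (G.ne_of_adj (by simpa using he)) (hunit u) (hunit v)

/-- The guarantee of the perturbed rounding. -/
lemma alphaGW_mul_sdpValue_add_le (hx : x ∈ sdpFeasible V) {η : ℝ} (hη : 0 < η)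
    (hη1 : η ≤ 1 / 10 ^ 4) {k : ℕ} (hk : HasTrianglePacking G k) :
    alphaGW * sdpValue G x + (k * (η / 1000) - 4 * η ^ 2 * G.edgeFinset.card) ≤
      ∫ ω, ((perturbGW G η x ω).card : ℝ) ∂randomness V := by
  refine le_trans ?_ (sum_separate'_le_integral G η x)
  have hunit : ∀ v, ‖x v‖ = 1 := fun v => mem_sphere_zero_iff_norm.1 (hx v)
  have hedge : ∀ e ∈ G.edgeFinset, alphaGW * edgeValue x e +
      ((if edgeValue x e ≤ 3 / 4 then η / 1000 else 0) - 4 * η ^ 2) ≤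
      (randomness V).real {ω | e ∈ cut G (side fun v => sign' η x ω.1 ω.2 v)} := by
    intro e he
    induction e using Sym2.ind with
    | _ u v =>
      simp only [mem_cut_side_iff G he]
      refine le_trans ?_ (le_randomness_separate' (G.ne_of_adj (by simpa using he)) (hunit u)
        (hunit v) hη hη1)
      have hiff : edgeValue x s(u, v) ≤ 3 / 4 ↔ -(1 / 2) ≤ (inner ℝ (x u) (x v) : ℝ) := by
        simp only [edgeValue, Sym2.lift_mk]
        constructor <;> intro h <;> linarith
      simp only [hiff]
      simp only [edgeValue, Sym2.lift_mk]
      split_ifs <;> linarith [sq_nonneg η]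
  have hsum := Finset.sum_le_sum hedge
  rw [Finset.sum_add_distrib, ← Finset.mul_sum, ← sdpValue_eq_sum, Finset.sum_sub_distrib,
    ← Finset.sum_filter, Finset.sum_const, Finset.sum_const, nsmul_eq_mul, nsmul_eq_mul] at hsum
  refine le_trans ?_ hsum
  have hcard : (k : ℝ) ≤ (G.edgeFinset.filter fun e => edgeValue x e ≤ 3 / 4).card := by
    exact_mod_cast le_card_edgeValue_le G hx hk
  have := mul_le_mul_of_nonneg_right hcard (by positivity : 0 ≤ η / 1000)
  linarith

end Cuts

end PerturbGW

theorem mainTheorem4 {V : Type*} [Fintype V] [DecidableEq V]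
    (G : SimpleGraph V) [DecidableRel G.Adj] (t : ℝ)
    (hpack : ∃ k : ℕ, t * (G.edgeFinset.card : ℝ) ≤ (k : ℝ) ∧ PerturbGW.HasTrianglePacking G k)
    (x : V → PerturbGW.Space V) (hx : PerturbGW.IsSDPOptimal G x) :
    MeasureTheory.Integrable
        (fun ω => ((PerturbGW.perturbGW G (t ^ 2 / 10 ^ 4) x ω).card : ℝ))
        (PerturbGW.randomness V) ∧
      (PerturbGW.alphaGW + t ^ 3 / 10 ^ 10) * (PerturbGW.mc G : ℝ) ≤
        ∫ ω, ((PerturbGW.perturbGW G (t ^ 2 / 10 ^ 4) x ω).card : ℝ) ∂(PerturbGW.randomness V) := by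
  refine ⟨PerturbGW.integrable_perturbGW G _ x, ?_⟩
  obtain ⟨k, hkt, hk⟩ := hpack
  have hα := mul_le_mul_of_nonneg_left (PerturbGW.mc_le_sdpValue hx) PerturbGW.alphaGW_nonneg
  have hmE : (PerturbGW.mc G : ℝ) ≤ G.edgeFinset.card := by
    exact_mod_cast PerturbGW.mc_le_card_edgeFinset G
  have hm0 : (0 : ℝ) ≤ PerturbGW.mc G := Nat.cast_nonneg _
  rw [add_mul]
  -- For `t ≤ 0` the extra term is nonpositive and the unperturbed cut suffices.
  rcases le_or_gt t 0 with ht | ht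
  · refine le_trans ?_ (PerturbGW.alphaGW_mul_sdpValue_le hx.1 _)
    have h3 : t ^ 3 / 10 ^ 10 ≤ 0 :=
      div_nonpos_of_nonpos_of_nonneg (Odd.pow_nonpos (by decide) ht) (by norm_num)
    linarith [mul_nonpos_of_nonpos_of_nonneg h3 hm0]
  rcases (Nat.cast_nonneg (α := ℝ) G.edgeFinset.card).eq_or_lt with hE | hE
  · have hm : (PerturbGW.mc G : ℝ) = 0 := by linarith
    rw [hm, mul_zero, mul_zero, add_zero]
    exact MeasureTheory.integral_nonneg fun _ => Nat.cast_nonneg _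
  · have hkE : (k : ℝ) ≤ G.edgeFinset.card := by
      exact_mod_cast (PerturbGW.le_card_edgeValue_le G hx.1 hk).trans (Finset.card_filter_le _ _)
    -- The packing yields `k` distinct edges, so `t |E| ≤ k ≤ |E|`. This gives `η ≤ 1 / 10⁴`.
    have ht1 : t ≤ 1 := le_of_mul_le_mul_right (by linarith) hE
    have ht2 : t ^ 2 ≤ 1 := pow_le_one₀ ht.le ht1
    have h := PerturbGW.alphaGW_mul_sdpValue_add_le hx.1 (η := t ^ 2 / 10 ^ 4) (by positivity)
      (by gcongr) hk
    refine le_trans ?_ h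
    have h1 : t ^ 3 / 10 ^ 10 * (PerturbGW.mc G : ℝ) ≤ t ^ 3 / 10 ^ 10 * G.edgeFinset.card := by
      gcongr
    -- Per edge of `G`, the gain is `t³ / 10⁷` and the loss `4 t⁴ / 10⁸ ≤ 0.4 t³ / 10⁷`, which
    -- leaves far more than `t³ / 10¹⁰`.
    have h2 := mul_le_mul_of_nonneg_right hkt (by positivity : 0 ≤ t ^ 2 / 10 ^ 4 / 1000)
    have h4 : t ^ 4 * (G.edgeFinset.card : ℝ) ≤ t ^ 3 * G.edgeFinset.card := by
      gcongr ?_ * _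
      exact pow_le_pow_of_le_one ht.le ht1 (by norm_num)
    have h5 : 0 ≤ t ^ 3 * (G.edgeFinset.card : ℝ) := by positivity
    linarith
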